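/- There is an absolute constant $C<\infty$ with the following property. Let $d\in\mathbb{N}$, let $\mu$ be a locally finite Borel measure on $\mathbb{R}^d$, let $\mathcal{D}$ be a finite collection of dyadic cubes $2^{-k}([0,1)^d+j)$ ($k\in\mathbb{Z}$, $j\in\mathbb{Z}^d$), and for each $Q\in\mathcal{D}$ let $\lambda_Q:\ell^2\to\ell^2$ be a bounded linear operator on the real sequence space $\ell^2$ whose (infinite) matrix with respect to the standard unit vectors is symmetric and has only non-negative entries. Write $\langle f\rangle_Q^\mu:=\frac{1}{\mu(Q)}\int_Q f\,d\mu\in\ell^2$ (Bochner integral), with $\langle f\rangle_Q^\mu:=0$ if $\mu(Q)=0$, and put $$ A:=\sup_{f\in L^2_{\ell^2}(\mu)}\frac{\sum_{Q\in\mathcal{D}}(\langle f\rangle_Q^\mu)^t\lambda_Q\langle f\rangle_Q^\mu}{\|f\|^2_{L^2_{\ell^2}(\mu)}},\qquad B:=\sup_{R\in\mathcal{D}}\ \sup_{f\in L^\infty_{\ell^2}(R,\mu)}\frac{\sum_{Q\in\mathcal{D}:\,Q\subseteq R}(\langle f\rangle_Q^\mu)^t\lambda_Q\langle f\rangle_Q^\mu}{\|f\|^2_{L^\infty_{\ell^2}(R,\mu)}\,\mu(R)},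 $$ where the suprema are taken in $[0,\infty]$ (negative quotients count as $0$, $0/0:=0$, and the supremum of the empty set is $0$). Then $A\le C\,B$ and $B\le C\,A$. In particular, $C$ does not depend on $d$, $\mu$, $\mathcal{D}$ or the matrices $\lambda_Q$. -/

import Mathlib

open MeasureTheory
open scoped ENNReal NNReal

namespace CarlesonEmbedding

noncomputable section

/-- The real sequence space `ℓ²`. -/
abbrev EllTwo : Type := lp (fun _ : ℕ => ℝ) 2

/-- The entry in row `i` and column `j` of the matrix of a bounded operator on `ℓ²`
with respect to the standard unit vectors. -/
def entry (T : EllTwo →L[ℝ] EllTwo) (i j : ℕ) : ℝ :=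
  (T (lp.single 2 j (1 : ℝ)) : ℕ → ℝ) i

/-- The matrix of `T` is symmetric. -/
def IsSymmMatrix (T : EllTwo →L[ℝ] EllTwo) : Prop :=
  ∀ i j : ℕ, entry T i j = entry T j i

/-- All entries of the matrix of `T` are non-negative. -/
def HasNonnegEntries (T : EllTwo →L[ℝ] EllTwo) : Prop :=
  ∀ i j : ℕ, 0 ≤ entry T i j

/-- Dyadic cubes `2^(-k) ([0,1)^d + j)` in `ℝ^d`, with `k ∈ ℤ` and `j ∈ ℤ^d`. -/
def IsDyadicCube {d : ℕ} (Q : Set (Fin d → ℝ)) : Prop :=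
  ∃ (k : ℤ) (j : Fin d → ℤ),
    Q = Set.univ.pi fun i =>
      Set.Ico ((2 : ℝ) ^ (-k) * (j i : ℝ)) ((2 : ℝ) ^ (-k) * ((j i : ℝ) + 1))

/-- The sum over `Q ∈ 𝒬` of `⟨f⟩_Q^t λ_Q ⟨f⟩_Q`, where `⟨f⟩_Q` is the `μ`-average of `f` over `Q`
(which is `0` if `μ Q = 0`). -/
def carlesonSum {d : ℕ} (μ : Measure (Fin d → ℝ)) (𝒬 : Finset (Set (Fin d → ℝ)))
    (lam : Set (Fin d → ℝ) → EllTwo →L[ℝ] EllTwo) (f : (Fin d → ℝ) → EllTwo) : ℝ :=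
  ∑ Q ∈ 𝒬, inner ℝ (⨍ x in Q, f x ∂μ) (lam Q (⨍ x in Q, f x ∂μ))

/-- The best constant in the embedding inequality: the supremum over `f ∈ L²(μ; ℓ²)` of
`∑_{Q ∈ 𝒟} ⟨f⟩_Q^t λ_Q ⟨f⟩_Q / ‖f‖²`. The supremum is taken in `[0, ∞]`, so that a negative
quotient counts as `0`; the quotient is `0 / 0 = 0` if `f = 0` almost everywhere. -/
def embeddingConst {d : ℕ} (μ : Measure (Fin d → ℝ)) (𝒟 : Finset (Set (Fin d → ℝ)))
    (lam : Set (Fin d → ℝ) → EllTwo →L[ℝ] EllTwo) : ℝ≥0∞ :=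
  ⨆ (f : (Fin d → ℝ) → EllTwo) (_ : MemLp f 2 μ),
    ENNReal.ofReal (carlesonSum μ 𝒟 lam f) / eLpNorm f 2 μ ^ 2

open scoped Classical in
/-- The `L^∞` testing constant: the supremum over `R ∈ 𝒟` and `f ∈ L^∞(R, μ; ℓ²)` of
`∑_{Q ∈ 𝒟, Q ⊆ R} ⟨f⟩_Q^t λ_Q ⟨f⟩_Q / (‖f‖_∞² μ(R))`, with the same conventions. -/
def testingConst {d : ℕ} (μ : Measure (Fin d → ℝ)) (𝒟 : Finset (Set (Fin d → ℝ)))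
    (lam : Set (Fin d → ℝ) → EllTwo →L[ℝ] EllTwo) : ℝ≥0∞ :=
  ⨆ (R : Set (Fin d → ℝ)) (_ : R ∈ 𝒟) (f : (Fin d → ℝ) → EllTwo)
    (_ : MemLp f ∞ (μ.restrict R)),
    ENNReal.ofReal (carlesonSum μ {Q ∈ 𝒟 | Q ⊆ R} lam f) /
      (eLpNorm f ∞ (μ.restrict R) ^ 2 * μ R)

end

end CarlesonEmbedding

/-!
The inequality `B ≤ A` for the testing constant `B` and the embedding constant `A` is soft. Since
the matrices have non-negative entries, their quadratic forms are monotone for the coordinatewise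
order (`inner_apply_le_inner_apply`), so a bounded `f` on `R` may be replaced by the function
`|f| 1_R`, for which the cubes not contained in `R` contribute non-negative terms.

For `A ≤ C B`, let `g` be the maximal function of `f` in the lattice `ℓ²` (`latticeMaximal`): its
`i`-th coordinate at `x` is the largest of the numbers `|⟨f_i⟩_Q|` with `x ∈ Q ∈ 𝒟`. Applying the
scalar dyadic maximal inequality (`lintegral_sq_le_of_le_maximal`) in each coordinate gives
`‖g‖_{L²(ℓ²)} ≤ √32 ‖f‖_{L²(ℓ²)}`. Say that `Q` has level `k` if `{‖g‖ > 2 ^ k}` fills more than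
half of `Q` but `{‖g‖ > 2 ^ (k + 1)}` does not (`exists_level`). On `Q` each coordinate of `g` is
at least `|⟨f_i⟩_Q|`, hence the truncation `h = g 1_{‖g‖ ≤ 2 ^ (k + 1)}`, which keeps `g` on at
least half of a cube `Q` of level `k`, satisfies `|⟨f_i⟩_Q| ≤ ⟨2 h_i⟩_Q`. As `h` is bounded, the
testing condition on a cube `R` controls all the cubes of level `k` inside `R` by
`16 B 4 ^ k μ(R)` (`ofReal_carlesonSum_le_of_subset`).

The maximal cubes `R` of level `k` are disjoint and more than half filled by `{‖g‖ > 2 ^ k}`, so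
level `k` contributes at most `32 B 4 ^ k μ(‖g‖ > 2 ^ k)` (`ofReal_carlesonSum_level_le`). The sum
of these bounds over `k` is at most `64 B ‖g‖²`, hence at most `2048 B ‖f‖²`. No doubling property
of `μ` enters, because the average of `g` over a cube is never compared with that over its parent.
-/

namespace CarlesonEmbedding

/-! ### Coordinatewise order and operators with non-negative entries on `ℓ²` -/

theorem enorm_sq_eq_tsum (v : EllTwo) : ‖v‖ₑ ^ 2 = ∑' i, ‖v i‖ₑ ^ 2 := by
  have h := lp.hasSum_norm (p := 2) (by norm_num) v
  simp only [ENNReal.toReal_ofNat, Real.rpow_ofNat] at h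
  have e : ∀ r : ℝ, ‖r‖ₑ ^ 2 = ENNReal.ofReal (‖r‖ ^ 2) := fun r => by
    rw [ENNReal.ofReal_pow (norm_nonneg _), ofReal_norm]
  rw [← ofReal_norm, ← ENNReal.ofReal_pow (norm_nonneg _), ← h.tsum_eq,
    ENNReal.ofReal_tsum_of_nonneg (fun _ => by positivity) h.summable]
  simp_rw [e]

theorem norm_le_norm_of_abs_le {u v : EllTwo} (h : ∀ i, |u i| ≤ v i) : ‖u‖ ≤ ‖v‖ :=
  lp.norm_mono (by norm_num) fun i => (h i).trans (le_abs_self _)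

theorem hasSum_entry_mul (T : EllTwo →L[ℝ] EllTwo) (u : EllTwo) (i : ℕ) :
    HasSum (fun j => entry T i j * u j) (T u i) := by
  have h := (lp.hasSum_single (p := 2) (by norm_num) u).mapL
    ((lp.evalCLM ℝ (fun _ : ℕ => ℝ) 2 i).comp T)
  refine h.congr_fun ?_
  intro j
  have e : lp.single 2 j (u j) = u j • (lp.single 2 j (1 : ℝ) : EllTwo) := by
    rw [← lp.single_smul]; simp
  rw [e, map_smul, smul_eq_mul, mul_comm]
  rfl

/-- The quadratic form of an operator with non-negative entries is monotone for the
coordinatewise order. -/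
theorem inner_apply_le_inner_apply {T : EllTwo →L[ℝ] EllTwo} (hT : HasNonnegEntries T)
    {u v : EllTwo} (h : ∀ i, |u i| ≤ v i) : inner ℝ u (T u) ≤ inner ℝ v (T v) := by
  have hTu : ∀ i, |T u i| ≤ T v i := fun i => by
    have hv := hasSum_entry_mul T v i
    have hu := hasSum_entry_mul T u i
    have hle : ∀ j, |entry T i j * u j| ≤ entry T i j * v j := fun j => by
      rw [abs_mul, abs_of_nonneg (hT i j)]
      exact mul_le_mul_of_nonneg_left (h j) (hT i j)
    exact abs_le.2 ⟨neg_le.1 (hasSum_le (fun j => (neg_le_abs _).trans (hle j)) hu.neg hv),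
      hasSum_le (fun j => (le_abs_self _).trans (hle j)) hu hv⟩
  refine hasSum_le (fun i => ?_) (lp.hasSum_inner u (T u)) (lp.hasSum_inner v (T v))
  simp only [RCLike.inner_apply, conj_trivial]
  calc T u i * u i ≤ |T u i| * |u i| := (le_abs_self _).trans (abs_mul _ _).le
    _ ≤ T v i * v i := mul_le_mul (hTu i) (h i) (abs_nonneg _) ((abs_nonneg _).trans (hTu i))

theorem inner_apply_nonneg {T : EllTwo →L[ℝ] EllTwo} (hT : HasNonnegEntries T)
    {v : EllTwo} (h : ∀ i, 0 ≤ v i) : 0 ≤ inner ℝ v (T v) := by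
  simpa using inner_apply_le_inner_apply hT (u := 0) (v := v) (by simpa using h)

/-- The coordinatewise supremum of the absolute values of finitely many vectors of `ℓ²`;
it is `0` for the empty family. -/
noncomputable def supAbs {ι : Type*} (s : Finset ι) (a : ι → EllTwo) : EllTwo :=
  ⟨fun i => ((s.sup fun q => ‖a q i‖₊ : ℝ≥0) : ℝ), by
    refine (lp.memℓp (∑ q ∈ s, lp.toNorm (a q))).mono fun i => ?_
    have h : (s.sup fun q => ‖a q i‖₊) ≤ ∑ q ∈ s, ‖a q i‖₊ :=
      Finset.sup_le fun q hq => Finset.single_le_sum (f := fun q => ‖a q i‖₊) (by simp) hq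
    rw [lp.coeFn_sum, Finset.sum_apply, Real.norm_of_nonneg (NNReal.coe_nonneg _)]
    simpa using NNReal.coe_le_coe.2 h⟩

theorem supAbs_apply {ι : Type*} (s : Finset ι) (a : ι → EllTwo) (i : ℕ) :
    supAbs s a i = ((s.sup fun q => ‖a q i‖₊ : ℝ≥0) : ℝ) := rfl

theorem supAbs_nonneg {ι : Type*} (s : Finset ι) (a : ι → EllTwo) (i : ℕ) : 0 ≤ supAbs s a i :=
  NNReal.coe_nonneg _

theorem abs_le_supAbs {ι : Type*} {s : Finset ι} (a : ι → EllTwo) {q : ι} (hq : q ∈ s) (i : ℕ) :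
    |a q i| ≤ supAbs s a i := by
  rw [supAbs_apply, ← Real.norm_eq_abs, ← coe_nnnorm, NNReal.coe_le_coe]
  exact Finset.le_sup (f := fun q => ‖a q i‖₊) hq

theorem continuous_toNorm : Continuous (fun v : EllTwo => (lp.toNorm v : EllTwo)) := by
  refine (LipschitzWith.of_dist_le_mul (K := 1) fun u v => ?_).continuous
  rw [NNReal.coe_one, one_mul, dist_eq_norm, dist_eq_norm]
  exact lp.norm_mono (by norm_num) fun i => abs_norm_sub_norm_le (u i) (v i)

/-! ### Sums over the dyadic levels `2 ^ k`, `k ∈ ℤ` -/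

theorem sum_two_zpow_le (K : Finset ℤ) :
    ∀ n : ℤ, (∀ k ∈ K, k ≤ n) → ∑ k ∈ K, (2 : ℝ≥0∞) ^ k ≤ 2 ^ (n + 1) := by
  have h2 : (2 : ℝ≥0∞) ≠ 0 := by norm_num
  have h2' : (2 : ℝ≥0∞) ≠ ⊤ := by norm_num
  induction K using Finset.induction_on_max with
  | empty => simp
  | insert m K hm ih =>
    intro n hn
    rw [Finset.sum_insert fun h => lt_irrefl _ (hm m h)]
    calc (2 : ℝ≥0∞) ^ m + ∑ k ∈ K, (2 : ℝ≥0∞) ^ k ≤ 2 ^ m + 2 ^ m := by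
          gcongr
          simpa using ih (m - 1) fun k hk => Int.le_sub_one_of_lt (hm k hk)
      _ = 2 ^ (m + 1) := by rw [ENNReal.zpow_add h2 h2', zpow_one, mul_two]
      _ ≤ 2 ^ (n + 1) := ENNReal.zpow_le_of_le (by norm_num)
          (by have := hn m (Finset.mem_insert_self _ _); lia)

theorem tsum_two_zpow_lt_le (t : ℝ≥0∞) :
    ∑' k : ℤ, (if (2 : ℝ≥0∞) ^ k < t then (2 : ℝ≥0∞) ^ k else 0) ≤ 2 * t := by
  have h2 : (2 : ℝ≥0∞) ≠ 0 := by norm_num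
  have h2' : (2 : ℝ≥0∞) ≠ ⊤ := by norm_num
  rcases eq_or_ne t 0 with rfl | h0
  · simp
  rcases eq_or_ne t ⊤ with rfl | htop
  · simp
  obtain ⟨n, hn, hn'⟩ := ENNReal.exists_mem_Ioc_zpow h0 htop (by norm_num : (1 : ℝ≥0∞) < 2) h2'
  refine ENNReal.summable.tsum_le_of_sum_le fun K => ?_
  rw [← Finset.sum_filter]
  refine (sum_two_zpow_le _ n fun k hk => ?_).trans ?_
  · by_contra! hlt
    exact absurd ((Finset.mem_filter.1 hk).2.trans_le hn') (not_lt.2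
      (ENNReal.zpow_le_of_le (by norm_num) (by lia)))
  · rw [ENNReal.zpow_add h2 h2', zpow_one, mul_comm]
    gcongr

theorem tsum_four_zpow_lt_le (t : ℝ≥0∞) :
    ∑' k : ℤ, (if (2 : ℝ≥0∞) ^ k < t then ((2 : ℝ≥0∞) ^ k) ^ 2 else 0) ≤ 2 * t ^ 2 := by
  calc _ ≤ ∑' k : ℤ, t * (if (2 : ℝ≥0∞) ^ k < t then (2 : ℝ≥0∞) ^ k else 0) := by
        refine ENNReal.tsum_le_tsum fun k => ?_
        split_ifs with h
        · rw [sq]; gcongr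
        · simp
    _ ≤ t * (2 * t) := by rw [ENNReal.tsum_mul_left]; gcongr; exact tsum_two_zpow_lt_le t
    _ = 2 * t ^ 2 := by ring

theorem sq_le_tsum_four_zpow_lt {t : ℝ≥0∞} (ht : t ≠ ⊤) :
    t ^ 2 ≤ 4 * ∑' k : ℤ, (if (2 : ℝ≥0∞) ^ k < t then ((2 : ℝ≥0∞) ^ k) ^ 2 else 0) := by
  have h2 : (2 : ℝ≥0∞) ≠ 0 := by norm_num
  have h2' : (2 : ℝ≥0∞) ≠ ⊤ := by norm_num
  rcases eq_or_ne t 0 with rfl | h0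
  · simp
  obtain ⟨n, hn, hn'⟩ := ENNReal.exists_mem_Ioc_zpow h0 ht (by norm_num : (1 : ℝ≥0∞) < 2) h2'
  calc t ^ 2 ≤ (2 ^ (n + 1)) ^ 2 := by gcongr
    _ = 4 * (if (2 : ℝ≥0∞) ^ n < t then ((2 : ℝ≥0∞) ^ n) ^ 2 else 0) := by
        rw [if_pos hn, ENNReal.zpow_add h2 h2', zpow_one]; ring
    _ ≤ _ := by gcongr; exact ENNReal.le_tsum n

/-! ### Dyadic cubes -/

theorem IsDyadicCube.measurableSet {d : ℕ} {Q : Set (Fin d → ℝ)} (hQ : IsDyadicCube Q) :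
    MeasurableSet Q := by
  obtain ⟨k, j, rfl⟩ := hQ
  exact MeasurableSet.univ_pi fun i => measurableSet_Ico

theorem IsDyadicCube.measure_lt_top {d : ℕ} {Q : Set (Fin d → ℝ)} (hQ : IsDyadicCube Q)
    (μ : Measure (Fin d → ℝ)) [IsLocallyFiniteMeasure μ] : μ Q < ⊤ := by
  obtain ⟨k, j, rfl⟩ := hQ
  exact (Bornology.IsBounded.pi fun i => Metric.isBounded_Ico _ _).measure_lt_top

theorem Ico_dyadic_subset {k k' : ℤ} (hk : k ≤ k') {j j' : ℤ} {x : ℝ}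
    (hx : x ∈ Set.Ico ((2 : ℝ) ^ (-k) * j) ((2 : ℝ) ^ (-k) * (j + 1)))
    (hx' : x ∈ Set.Ico ((2 : ℝ) ^ (-k') * j') ((2 : ℝ) ^ (-k') * (j' + 1))) :
    Set.Ico ((2 : ℝ) ^ (-k') * (j' : ℝ)) ((2 : ℝ) ^ (-k') * (j' + 1)) ⊆
      Set.Ico ((2 : ℝ) ^ (-k) * (j : ℝ)) ((2 : ℝ) ^ (-k) * (j + 1)) := by
  obtain ⟨n, rfl⟩ := Int.le.dest hk
  have hp : (0 : ℝ) < 2 ^ (-(k + n)) := by positivity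
  have e : (2 : ℝ) ^ (-k) = 2 ^ (-(k + n)) * ((2 ^ n : ℤ) : ℝ) := by
    push_cast
    rw [← zpow_natCast, ← zpow_add₀ two_ne_zero]
    congr 1; ring
  rw [e, mul_assoc, mul_assoc] at hx ⊢
  have h1 : 2 ^ n * j < j' + 1 := by
    have := lt_of_mul_lt_mul_left (hx.1.trans_lt hx'.2) hp.le
    exact_mod_cast this
  have h2 : j' < 2 ^ n * (j + 1) := by
    have := lt_of_mul_lt_mul_left (hx'.1.trans_lt hx.2) hp.le
    exact_mod_cast this
  refine Set.Ico_subset_Ico (mul_le_mul_of_nonneg_left ?_ hp.le)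
    (mul_le_mul_of_nonneg_left ?_ hp.le)
  · exact_mod_cast Int.lt_add_one_iff.1 h1
  · exact_mod_cast Int.add_one_le_iff.2 h2

theorem IsDyadicCube.subset_or_subset_or_disjoint {d : ℕ} {Q R : Set (Fin d → ℝ)}
    (hQ : IsDyadicCube Q) (hR : IsDyadicCube R) : Q ⊆ R ∨ R ⊆ Q ∨ Disjoint Q R := by
  by_cases hd : Disjoint Q R
  · exact Or.inr (Or.inr hd)
  obtain ⟨x, hxQ, hxR⟩ := Set.not_disjoint_iff.1 hd
  obtain ⟨k, j, rfl⟩ := hQ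
  obtain ⟨k', j', rfl⟩ := hR
  rcases le_total k k' with h | h
  · exact Or.inr (Or.inl (Set.pi_mono fun i hi => Ico_dyadic_subset h (hxQ i hi) (hxR i hi)))
  · exact Or.inl (Set.pi_mono fun i hi => Ico_dyadic_subset h (hxR i hi) (hxQ i hi))

/-- The maximal cubes of a finite family of dyadic cubes are disjoint and contain all the others.
Hence, if `μ Q ≤ c ν(Q)` for each cube `Q` of the family, the total `μ`-mass of the maximal cubes
is at most `c ν(ℝ^d)`. -/
theorem exists_maximal_subfamily {d : ℕ} {S : Finset (Set (Fin d → ℝ))}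
    (hS : ∀ Q ∈ S, IsDyadicCube Q) : ∃ S' ⊆ S, (∀ Q ∈ S, ∃ R ∈ S', Q ⊆ R) ∧
      ∀ (μ ν : Measure (Fin d → ℝ)) (c : ℝ≥0∞), (∀ Q ∈ S, μ Q ≤ c * ν Q) →
        ∑ R ∈ S', μ R ≤ c * ν Set.univ := by
  classical
  refine ⟨{R ∈ S | Maximal (· ∈ S) R}, Finset.filter_subset _ _, fun Q hQ => ?_,
    fun μ ν c h => ?_⟩
  · obtain ⟨R, hQR, hR⟩ := S.exists_le_maximal hQ
    exact ⟨R, Finset.mem_filter.2 ⟨hR.1, hR⟩, hQR⟩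
  · have hdisj : (({R ∈ S | Maximal (· ∈ S) R} : Finset (Set (Fin d → ℝ))) :
        Set (Set (Fin d → ℝ))).PairwiseDisjoint id := by
      intro Q hQ R hR hne
      simp only [Finset.coe_filter, Set.mem_ofPred_eq] at hQ hR
      rcases (hS Q hQ.1).subset_or_subset_or_disjoint (hS R hR.1) with h | h | h
      · exact absurd (hQ.2.eq_of_le hR.1 h) hne
      · exact absurd (hR.2.eq_of_le hQ.1 h) hne.symm
      · exact h
    calc ∑ R ∈ S with Maximal (· ∈ S) R, μ R ≤ ∑ R ∈ S with Maximal (· ∈ S) R, c * ν R :=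
          Finset.sum_le_sum fun R hR => h R (Finset.mem_filter.1 hR).1
      _ = c * ν (⋃ R ∈ ({R ∈ S | Maximal (· ∈ S) R} : Finset (Set (Fin d → ℝ))), id R) := by
          rw [← Finset.mul_sum, measure_biUnion_finset hdisj fun R hR =>
            (hS R (Finset.mem_filter.1 hR).1).measurableSet]
          rfl
      _ ≤ c * ν Set.univ := by gcongr; exact Set.subset_univ _

/-! ### The dyadic maximal inequality -/

/-- The weak-type estimate for the maximal function of the finite family `𝒟`, in truncated form:
only the part of `φ` above `t` is needed to control the cubes on which the average of `φ` is at
least `2 t`. -/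
theorem measure_biUnion_le_of_average_ge {d : ℕ} (μ : Measure (Fin d → ℝ))
    [IsLocallyFiniteMeasure μ] {S : Finset (Set (Fin d → ℝ))} (hS : ∀ Q ∈ S, IsDyadicCube Q)
    (φ : (Fin d → ℝ) → ℝ≥0∞) {t : ℝ≥0∞} (ht0 : t ≠ 0) (ht : t ≠ ⊤)
    (h : ∀ Q ∈ S, 2 * t * μ Q ≤ ∫⁻ x in Q, φ x ∂μ) :
    μ (⋃ Q ∈ S, Q) ≤ t⁻¹ * ∫⁻ x, (if t < φ x then φ x else 0) ∂μ := by
  obtain ⟨S', hS', hcov, hsum⟩ := exists_maximal_subfamily hS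
  calc μ (⋃ Q ∈ S, Q) ≤ μ (⋃ R ∈ S', R) := by
        refine measure_mono (Set.iUnion₂_subset fun Q hQ => ?_)
        obtain ⟨R, hR, hQR⟩ := hcov Q hQ
        exact hQR.trans (Set.subset_biUnion_of_mem (u := fun R => R) hR)
    _ ≤ ∑ R ∈ S', μ R := measure_biUnion_finset_le _ _
    _ ≤ t⁻¹ * μ.withDensity (fun x => if t < φ x then φ x else 0) Set.univ := by
        refine hsum _ _ _ fun Q hQ => ?_
        rw [withDensity_apply _ (hS Q hQ).measurableSet]
        have hfin : t * μ Q ≠ ⊤ := ENNReal.mul_ne_top ht ((hS Q hQ).measure_lt_top μ).ne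
        have h1 : t * μ Q + t * μ Q ≤
            t * μ Q + ∫⁻ x in Q, (if t < φ x then φ x else 0) ∂μ := by
          calc t * μ Q + t * μ Q = 2 * t * μ Q := by ring
            _ ≤ ∫⁻ x in Q, φ x ∂μ := h Q hQ
            _ ≤ ∫⁻ x in Q, (t + if t < φ x then φ x else 0) ∂μ := by
                refine lintegral_mono fun x => ?_
                split_ifs with hx
                · exact le_add_self
                · simpa using hx
            _ = _ := by rw [lintegral_add_left measurable_const, setLIntegral_const]
        rw [ENNReal.add_le_add_iff_left hfin] at h1
        rwa [← ENNReal.div_eq_inv_mul, ENNReal.le_div_iff_mul_le (Or.inl ht0) (Or.inl ht), mul_comm]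
    _ = _ := by rw [withDensity_apply _ MeasurableSet.univ, Measure.restrict_univ]

/-- The `L²` bound for the dyadic maximal function, for any function `G` that is
dominated by it. -/
theorem lintegral_sq_le_of_le_maximal {d : ℕ} (μ : Measure (Fin d → ℝ))
    [IsLocallyFiniteMeasure μ] {𝒟 : Finset (Set (Fin d → ℝ))} (h𝒟 : ∀ Q ∈ 𝒟, IsDyadicCube Q)
    {φ : (Fin d → ℝ) → ℝ≥0∞} (hφ : AEMeasurable φ μ) {G : (Fin d → ℝ) → ℝ≥0∞}
    (hG : ∀ x, G x ≠ ⊤)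
    (h : ∀ x t, t < G x → ∃ Q ∈ 𝒟, x ∈ Q ∧ t * μ Q ≤ ∫⁻ y in Q, φ y ∂μ) :
    ∫⁻ x, G x ^ 2 ∂μ ≤ 32 * ∫⁻ x, φ x ^ 2 ∂μ := by
  classical
  have h2 : (2 : ℝ≥0∞) ≠ 0 := by norm_num
  have h2' : (2 : ℝ≥0∞) ≠ ⊤ := by norm_num
  -- Level `k` is paired with the truncation height `2 ^ k`, so that it concerns averages above
  -- `2 ^ (k + 1) = 2 * 2 ^ k`.
  set S : ℤ → Finset (Set (Fin d → ℝ)) := fun k =>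
    {Q ∈ 𝒟 | 2 * 2 ^ k * μ Q ≤ ∫⁻ y in Q, φ y ∂μ} with hSdef
  have hS : ∀ k, ∀ Q ∈ S k, IsDyadicCube Q := fun k Q hQ => h𝒟 Q (Finset.mem_filter.1 hQ).1
  set E : ℤ → Set (Fin d → ℝ) := fun k => ⋃ Q ∈ S k, Q
  have hE : ∀ k, MeasurableSet (E k) := fun k =>
    Finset.measurableSet_biUnion _ fun Q hQ => (hS k Q hQ).measurableSet
  have hpt : ∀ x, G x ^ 2 ≤ ∑' k : ℤ, 16 * (E k).indicator (fun _ => ((2 : ℝ≥0∞) ^ k) ^ 2) x := by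
    intro x
    refine (sq_le_tsum_four_zpow_lt (hG x)).trans ?_
    rw [← ENNReal.tsum_mul_left, ← (Equiv.addRight (1 : ℤ)).tsum_eq]
    refine ENNReal.tsum_le_tsum fun k => ?_
    have e : (2 : ℝ≥0∞) ^ (k + 1) = 2 * 2 ^ k := by
      rw [ENNReal.zpow_add h2 h2', zpow_one, mul_comm]
    simp only [Equiv.coe_addRight, e]
    split_ifs with hx
    · obtain ⟨Q, hQ, hxQ, hle⟩ := h x _ hx
      have hxE : x ∈ E k := Set.mem_biUnion (Finset.mem_filter.2 ⟨hQ, hle⟩) hxQ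
      rw [Set.indicator_of_mem hxE]
      apply le_of_eq; ring
    · simp
  have hmeas : ∀ t : ℝ≥0∞, AEMeasurable (fun x => if t < φ x then φ x else 0) μ := fun t =>
    (Measurable.ite measurableSet_Ioi measurable_id measurable_const :
      Measurable fun y : ℝ≥0∞ => if t < y then y else 0).comp_aemeasurable hφ
  calc ∫⁻ x, G x ^ 2 ∂μ
      ≤ ∫⁻ x, ∑' k : ℤ, 16 * (E k).indicator (fun _ => ((2 : ℝ≥0∞) ^ k) ^ 2) x ∂μ :=
        lintegral_mono hpt
    _ = ∑' k : ℤ, 16 * (((2 : ℝ≥0∞) ^ k) ^ 2 * μ (E k)) := by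
        rw [lintegral_tsum fun k => ((measurable_const.indicator (hE k)).const_mul _).aemeasurable]
        congr 1 with k
        rw [lintegral_const_mul _ (measurable_const.indicator (hE k)),
          lintegral_indicator_const (hE k)]
    _ ≤ ∑' k : ℤ, ∫⁻ x, 16 * (2 ^ k * if 2 ^ k < φ x then φ x else 0) ∂μ := by
        refine ENNReal.tsum_le_tsum fun k => ?_
        have hk0 : (2 : ℝ≥0∞) ^ k ≠ 0 := (ENNReal.zpow_pos h2 h2' k).ne'
        have hk : (2 : ℝ≥0∞) ^ k ≠ ⊤ := (ENNReal.zpow_lt_top h2 h2' k).ne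
        rw [lintegral_const_mul'' _ ((hmeas _).const_mul _), lintegral_const_mul'' _ (hmeas _)]
        refine mul_le_mul_right ?_ _
        calc ((2 : ℝ≥0∞) ^ k) ^ 2 * μ (E k) ≤ (2 ^ k) ^ 2 *
              ((2 ^ k)⁻¹ * ∫⁻ x, (if 2 ^ k < φ x then φ x else 0) ∂μ) := by
              gcongr
              exact measure_biUnion_le_of_average_ge μ (hS k) φ hk0 hk
                fun Q hQ => (Finset.mem_filter.1 hQ).2
          _ = _ := by
              rw [sq, mul_assoc, ← mul_assoc ((2 : ℝ≥0∞) ^ k) (2 ^ k)⁻¹,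
                ENNReal.mul_inv_cancel hk0 hk, one_mul]
    _ = ∫⁻ x, ∑' k : ℤ, 16 * (2 ^ k * if 2 ^ k < φ x then φ x else 0) ∂μ := by
        rw [lintegral_tsum fun k => ((hmeas _).const_mul _).const_mul _]
    _ ≤ ∫⁻ x, 32 * φ x ^ 2 ∂μ := by
        refine lintegral_mono fun x => ?_
        rw [ENNReal.tsum_mul_left]
        calc 16 * ∑' k : ℤ, (2 ^ k * if 2 ^ k < φ x then φ x else 0)
            = 16 * (φ x * ∑' k : ℤ, if (2 : ℝ≥0∞) ^ k < φ x then 2 ^ k else 0) := by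
              refine congrArg (16 * ·) ?_
              rw [← ENNReal.tsum_mul_left]
              refine tsum_congr fun k => ?_
              split_ifs <;> simp [mul_comm]
          _ ≤ 16 * (φ x * (2 * φ x)) := by gcongr; exact tsum_two_zpow_lt_le _
          _ = 32 * φ x ^ 2 := by ring
    _ = 32 * ∫⁻ x, φ x ^ 2 ∂μ := lintegral_const_mul'' _ (hφ.pow_const 2)

/-! ### Averages of `ℓ²`-valued functions -/

theorem setAverage_apply {X : Type*} [MeasurableSpace X] {μ : Measure X} {Q : Set X}
    {f : X → EllTwo} (hf : IntegrableOn f Q μ) (i : ℕ) :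
    (⨍ x in Q, f x ∂μ) i = ⨍ x in Q, f x i ∂μ := by
  rw [setAverage_eq, setAverage_eq, lp.coeFn_smul, Pi.smul_apply]
  congr 1
  exact ((lp.evalCLM ℝ (fun _ : ℕ => ℝ) 2 i).integral_comp_comm hf).symm

theorem setAverage_apply_nonneg {X : Type*} [MeasurableSpace X] {μ : Measure X} {Q : Set X}
    {f : X → EllTwo} (hf : IntegrableOn f Q μ) (h0 : ∀ x i, 0 ≤ f x i) (i : ℕ) :
    0 ≤ (⨍ x in Q, f x ∂μ) i := by
  rw [setAverage_apply hf, setAverage_eq]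
  exact smul_nonneg (by positivity) (integral_nonneg fun x => h0 x i)

theorem abs_setAverage_apply_le {X : Type*} [MeasurableSpace X] {μ : Measure X} {Q : Set X}
    {f g : X → EllTwo} (hf : IntegrableOn f Q μ) (hg : IntegrableOn g Q μ)
    (h : ∀ᵐ x ∂μ.restrict Q, ∀ i, |f x i| ≤ g x i) (i : ℕ) :
    |(⨍ x in Q, f x ∂μ) i| ≤ (⨍ x in Q, g x ∂μ) i := by
  rw [setAverage_apply hf, setAverage_apply hg, setAverage_eq, setAverage_eq, smul_eq_mul,
    smul_eq_mul, abs_mul, abs_of_nonneg (by positivity : 0 ≤ (μ.real Q)⁻¹)]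
  refine mul_le_mul_of_nonneg_left ?_ (by positivity)
  have hgi : Integrable (fun x => g x i) (μ.restrict Q) :=
    (lp.evalCLM ℝ (fun _ : ℕ => ℝ) 2 i).integrable_comp hg
  exact norm_integral_le_of_norm_le (f := fun x => f x i) hgi (h.mono fun x hx => hx i)

theorem measure_mul_enorm_setAverage_apply_le {X : Type*} [MeasurableSpace X] {μ : Measure X}
    {Q : Set X} (hQ : μ Q ≠ ⊤) {f : X → EllTwo} (hf : IntegrableOn f Q μ) (i : ℕ) :
    ‖(⨍ x in Q, f x ∂μ) i‖ₑ * μ Q ≤ ∫⁻ x in Q, ‖f x i‖ₑ ∂μ := by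
  rw [setAverage_apply hf]
  calc ‖⨍ x in Q, f x i ∂μ‖ₑ * μ Q = ‖μ.real Q • ⨍ x in Q, f x i ∂μ‖ₑ := by
        rw [enorm_smul, mul_comm, Real.enorm_of_nonneg measureReal_nonneg,
          ofReal_measureReal hQ]
    _ = ‖∫ x in Q, f x i ∂μ‖ₑ := by rw [measure_smul_setAverage _ hQ]
    _ ≤ _ := enorm_integral_le_lintegral_enorm _

/-- If a function with non-negative coordinates is at least `u` on half of `Q`, then twice its
average over `Q` is at least `u`. -/
theorem abs_le_setAverage_two_smul {X : Type*} [MeasurableSpace X] {μ : Measure X}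
    {Q E : Set X} (hQ0 : μ Q ≠ 0) (hQ : μ Q ≠ ⊤) (hEQ : E ⊆ Q) (hE : MeasurableSet E)
    (hEhalf : μ Q ≤ 2 * μ E) {h : X → EllTwo} (hh : IntegrableOn h Q μ)
    (h0 : ∀ x i, 0 ≤ h x i) {u : EllTwo} (hu : ∀ x ∈ E, ∀ i, |u i| ≤ h x i) (i : ℕ) :
    |u i| ≤ (⨍ x in Q, (2 : ℝ) • h x ∂μ) i := by
  have hQpos : 0 < μ.real Q := ENNReal.toReal_pos hQ0 hQ
  have hhi : IntegrableOn (fun x => h x i) Q μ :=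
    (lp.evalCLM ℝ (fun _ : ℕ => ℝ) 2 i).integrable_comp hh
  have hEtop : μ E ≠ ⊤ := ((measure_mono hEQ).trans_lt hQ.lt_top).ne
  have hhalf : μ.real Q ≤ 2 * μ.real E := by
    have := ENNReal.toReal_mono (ENNReal.mul_ne_top (by norm_num) hEtop) hEhalf
    simpa [Measure.real, ENNReal.toReal_mul] using this
  have hint : μ.real E * |u i| ≤ ∫ x in Q, h x i ∂μ :=
    calc μ.real E * |u i| = ∫ _ in E, |u i| ∂μ := by rw [setIntegral_const, smul_eq_mul]
      _ ≤ ∫ x in E, h x i ∂μ := setIntegral_mono_on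
          (integrableOn_const hEtop) (hhi.mono_set hEQ) hE fun x hx => hu x hx i
      _ ≤ ∫ x in Q, h x i ∂μ := setIntegral_mono_set hhi
          (Filter.Eventually.of_forall fun x => h0 x i) hEQ.eventuallyLE
  have havg : (⨍ x in Q, (2 : ℝ) • h x ∂μ) i = (μ.real Q)⁻¹ * (2 * ∫ x in Q, h x i ∂μ) := by
    refine (setAverage_apply (f := fun x => (2 : ℝ) • h x) (hh.smul (2 : ℝ)) i).trans ?_
    rw [setAverage_eq, smul_eq_mul, ← integral_const_mul 2]
    rfl
  rw [havg, inv_mul_eq_div, le_div_iff₀ hQpos]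
  nlinarith [abs_nonneg (u i)]

/-! ### The Carleson sum and the two constants -/

variable {d : ℕ} {μ : Measure (Fin d → ℝ)} {𝒟 : Finset (Set (Fin d → ℝ))}
  {lam : Set (Fin d → ℝ) → EllTwo →L[ℝ] EllTwo}

theorem carlesonSum_le_carlesonSum {F F' : Finset (Set (Fin d → ℝ))} (hF : F ⊆ F')
    (hlam : ∀ Q ∈ F', HasNonnegEntries (lam Q)) {f g : (Fin d → ℝ) → EllTwo}
    (hfg : ∀ Q ∈ F, ∀ i, |(⨍ x in Q, f x ∂μ) i| ≤ (⨍ x in Q, g x ∂μ) i)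
    (hg : ∀ Q ∈ F', ∀ i, 0 ≤ (⨍ x in Q, g x ∂μ) i) :
    carlesonSum μ F lam f ≤ carlesonSum μ F' lam g :=
  (Finset.sum_le_sum fun Q hQ => inner_apply_le_inner_apply (hlam Q (hF hQ)) (hfg Q hQ)).trans
    (Finset.sum_le_sum_of_subset_of_nonneg hF fun Q hQ _ =>
      inner_apply_nonneg (hlam Q hQ) (hg Q hQ))

theorem carlesonSum_eq_zero {F : Finset (Set (Fin d → ℝ))} {f : (Fin d → ℝ) → EllTwo}
    (hf : ∀ Q ∈ F, f =ᵐ[μ.restrict Q] 0) : carlesonSum μ F lam f = 0 := by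
  refine Finset.sum_eq_zero fun Q hQ => ?_
  have : ⨍ x in Q, f x ∂μ = 0 := by
    rw [setAverage_eq, integral_congr_ae (hf Q hQ)]
    simp
  rw [this, inner_zero_left]

/-- The embedding inequality with its best constant; the point is that it also holds where the
quotient in the definition is `0 / 0`. -/
theorem ofReal_carlesonSum_le_embeddingConst_mul {f : (Fin d → ℝ) → EllTwo} (hf : MemLp f 2 μ) :
    ENNReal.ofReal (carlesonSum μ 𝒟 lam f) ≤ embeddingConst μ 𝒟 lam * eLpNorm f 2 μ ^ 2 := by
  by_cases h0 : eLpNorm f 2 μ = 0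
  · have hz : f =ᵐ[μ] 0 := (eLpNorm_eq_zero_iff hf.1 (by norm_num)).1 h0
    rw [carlesonSum_eq_zero fun Q _ => ae_restrict_of_ae hz]
    simp
  · rw [← ENNReal.div_le_iff (pow_ne_zero 2 h0) (ENNReal.pow_ne_top hf.2.ne)]
    exact le_iSup₂ (f := fun (f : (Fin d → ℝ) → EllTwo) (_ : MemLp f 2 μ) =>
      ENNReal.ofReal (carlesonSum μ 𝒟 lam f) / eLpNorm f 2 μ ^ 2) f hf

open scoped Classical in
/-- The testing inequality with its best constant; the point is that it also holds where the
quotient in the definition is `0 / 0`. -/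
theorem ofReal_carlesonSum_le_testingConst_mul {R : Set (Fin d → ℝ)} (hR : R ∈ 𝒟)
    (hRtop : μ R ≠ ⊤) {f : (Fin d → ℝ) → EllTwo} (hf : MemLp f ∞ (μ.restrict R)) :
    ENNReal.ofReal (carlesonSum μ {Q ∈ 𝒟 | Q ⊆ R} lam f) ≤
      testingConst μ 𝒟 lam * (eLpNorm f ∞ (μ.restrict R) ^ 2 * μ R) := by
  by_cases h0 : eLpNorm f ∞ (μ.restrict R) ^ 2 * μ R = 0
  · have hz : f =ᵐ[μ.restrict R] 0 := by
      rcases mul_eq_zero.1 h0 with h | h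
      · exact (eLpNorm_eq_zero_iff hf.1 (by norm_num)).1 (pow_eq_zero_iff two_ne_zero |>.1 h)
      · rw [Measure.restrict_eq_zero.2 h]
        simp [Filter.EventuallyEq]
    rw [carlesonSum_eq_zero fun Q hQ =>
      ae_restrict_of_ae_restrict_of_subset (Finset.mem_filter.1 hQ).2 hz]
    simp
  · rw [← ENNReal.div_le_iff h0 (ENNReal.mul_ne_top (ENNReal.pow_ne_top hf.2.ne) hRtop)]
    exact le_iSup₂_of_le R hR (le_iSup₂ (f := fun (f : (Fin d → ℝ) → EllTwo)
      (_ : MemLp f ∞ (μ.restrict R)) => ENNReal.ofReal (carlesonSum μ {Q ∈ 𝒟 | Q ⊆ R} lam f) /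
      (eLpNorm f ∞ (μ.restrict R) ^ 2 * μ R)) f hf)

theorem eLpNorm_two_sq (f : (Fin d → ℝ) → EllTwo) :
    eLpNorm f 2 μ ^ 2 = ∫⁻ x, ‖f x‖ₑ ^ 2 ∂μ := by
  rw [eLpNorm_eq_lintegral_rpow_enorm_toReal (by norm_num) (by norm_num)]
  simp only [ENNReal.toReal_ofNat, ENNReal.rpow_ofNat]
  rw [← ENNReal.rpow_natCast, ← ENNReal.rpow_mul]
  norm_num

theorem testingConst_le_embeddingConst [IsLocallyFiniteMeasure μ]
    (h𝒟 : ∀ Q ∈ 𝒟, IsDyadicCube Q) (hlam : ∀ Q ∈ 𝒟, HasNonnegEntries (lam Q)) :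
    testingConst μ 𝒟 lam ≤ embeddingConst μ 𝒟 lam := by
  classical
  refine iSup₂_le fun R hR => iSup₂_le fun f hf => ENNReal.div_le_of_le_mul ?_
  have hRm := (h𝒟 R hR).measurableSet
  have : IsFiniteMeasure (μ.restrict R) := ⟨by simpa using (h𝒟 R hR).measure_lt_top μ⟩
  -- Taking absolute values makes the terms with `Q ⊄ R` non-negative.
  set F : (Fin d → ℝ) → EllTwo := R.indicator fun x => lp.toNorm (f x) with hF
  have hnorm : MemLp (fun x => (lp.toNorm (f x) : EllTwo)) ∞ (μ.restrict R) :=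
    hf.of_le (continuous_toNorm.comp_aestronglyMeasurable hf.1)
      (Filter.Eventually.of_forall fun x => lp.norm_toNorm.le)
  have hF2 : MemLp F 2 μ := (memLp_indicator_iff_restrict hRm).2 (hnorm.mono_exponent le_top)
  have hFint : ∀ Q ∈ 𝒟, IntegrableOn F Q μ := fun Q hQ => by
    have : IsFiniteMeasure (μ.restrict Q) := ⟨by simpa using (h𝒟 Q hQ).measure_lt_top μ⟩
    exact (hF2.restrict Q).integrable (by norm_num)
  have hF0 : ∀ x i, 0 ≤ F x i := fun x i => by
    by_cases hx : x ∈ R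
    · rw [hF, Set.indicator_of_mem hx]; exact norm_nonneg _
    · rw [hF, Set.indicator_of_notMem hx]; exact le_rfl
  calc ENNReal.ofReal (carlesonSum μ {Q ∈ 𝒟 | Q ⊆ R} lam f)
      ≤ ENNReal.ofReal (carlesonSum μ 𝒟 lam F) := by
        refine ENNReal.ofReal_le_ofReal (carlesonSum_le_carlesonSum (Finset.filter_subset _ _) hlam
          (fun Q hQ => ?_) fun Q hQ => setAverage_apply_nonneg (hFint Q hQ) hF0)
        obtain ⟨hQ, hQR⟩ := Finset.mem_filter.1 hQ
        refine abs_setAverage_apply_le (IntegrableOn.mono_set (hf.integrable le_top) hQR)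
          (hFint Q hQ) ?_
        filter_upwards [ae_restrict_mem (h𝒟 Q hQ).measurableSet] with x hx i
        rw [hF, Set.indicator_of_mem (hQR hx)]
        exact le_rfl
    _ ≤ embeddingConst μ 𝒟 lam * eLpNorm F 2 μ ^ 2 := ofReal_carlesonSum_le_embeddingConst_mul hF2
    _ ≤ embeddingConst μ 𝒟 lam * (eLpNorm f ∞ (μ.restrict R) ^ 2 * μ R) := by
        gcongr
        rw [hF, eLpNorm_indicator_eq_eLpNorm_restrict hRm, eLpNorm_two_sq]
        calc ∫⁻ x in R, ‖(lp.toNorm (f x) : EllTwo)‖ₑ ^ 2 ∂μ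
            ≤ ∫⁻ _ in R, eLpNorm f ∞ (μ.restrict R) ^ 2 ∂μ := by
              refine lintegral_mono_ae ?_
              filter_upwards [enorm_ae_le_eLpNormEssSup f (μ.restrict R)] with x hx
              rw [← ofReal_norm, lp.norm_toNorm, ofReal_norm, eLpNorm_exponent_top]
              gcongr
          _ = _ := by rw [setLIntegral_const]

/-! ### The lattice maximal function -/

open scoped Classical in
/-- The maximal function of `f` over the finite family `𝒟`, in the lattice `ℓ²`: its `i`-th
coordinate at `x` is the largest absolute value of the averages of the `i`-th coordinate of `f`
over the cubes `Q ∈ 𝒟` that contain `x`. -/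
noncomputable def latticeMaximal (μ : Measure (Fin d → ℝ)) (𝒟 : Finset (Set (Fin d → ℝ)))
    (f : (Fin d → ℝ) → EllTwo) (x : Fin d → ℝ) : EllTwo :=
  supAbs {Q ∈ 𝒟 | x ∈ Q} fun Q => ⨍ y in Q, f y ∂μ

theorem latticeMaximal_nonneg (f : (Fin d → ℝ) → EllTwo) (x : Fin d → ℝ) (i : ℕ) :
    0 ≤ latticeMaximal μ 𝒟 f x i := supAbs_nonneg _ _ _

theorem abs_setAverage_le_latticeMaximal (f : (Fin d → ℝ) → EllTwo) {Q : Set (Fin d → ℝ)}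
    (hQ : Q ∈ 𝒟) {x : Fin d → ℝ} (hx : x ∈ Q) (i : ℕ) :
    |(⨍ y in Q, f y ∂μ) i| ≤ latticeMaximal μ 𝒟 f x i := by
  classical
  exact abs_le_supAbs (fun Q => ⨍ y in Q, f y ∂μ) (Finset.mem_filter.2 ⟨hQ, hx⟩) i

theorem norm_latticeMaximal_le (f : (Fin d → ℝ) → EllTwo) (x : Fin d → ℝ) :
    ‖latticeMaximal μ 𝒟 f x‖ ≤ ‖supAbs 𝒟 fun Q => ⨍ y in Q, f y ∂μ‖ := by
  refine norm_le_norm_of_abs_le fun i => ?_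
  classical
  rw [abs_of_nonneg (latticeMaximal_nonneg f x i), latticeMaximal, supAbs_apply, supAbs_apply,
    NNReal.coe_le_coe]
  exact Finset.sup_mono (Finset.filter_subset _ _)

theorem stronglyMeasurable_latticeMaximal (h𝒟 : ∀ Q ∈ 𝒟, MeasurableSet Q)
    (f : (Fin d → ℝ) → EllTwo) : StronglyMeasurable (latticeMaximal μ 𝒟 f) := by
  classical
  -- The value at `x` depends only on which of the finitely many cubes contain `x`.
  let G : (𝒟 → Prop) → EllTwo := fun p =>
    supAbs {Q ∈ 𝒟 | ∃ h : Q ∈ 𝒟, p ⟨Q, h⟩} fun Q => ⨍ y in Q, f y ∂μ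
  have hG : StronglyMeasurable G := StronglyMeasurable.of_discrete
  have hm : Measurable fun (x : Fin d → ℝ) (Q : 𝒟) => x ∈ (Q : Set (Fin d → ℝ)) :=
    measurable_pi_lambda _ fun Q => measurableSet_setOfPred.1 (h𝒟 Q Q.2)
  convert hG.comp_measurable hm using 1
  funext x
  simp only [latticeMaximal, G, Function.comp]
  congr 1
  exact Finset.filter_congr fun Q hQ => by simp [hQ]

theorem lintegral_latticeMaximal_sq_le [IsLocallyFiniteMeasure μ]
    (h𝒟 : ∀ Q ∈ 𝒟, IsDyadicCube Q) {f : (Fin d → ℝ) → EllTwo} (hf : AEStronglyMeasurable f μ)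
    (hfint : ∀ Q ∈ 𝒟, IntegrableOn f Q μ) :
    ∫⁻ x, ‖latticeMaximal μ 𝒟 f x‖ₑ ^ 2 ∂μ ≤ 32 * ∫⁻ x, ‖f x‖ₑ ^ 2 ∂μ := by
  classical
  have hcoord : ∀ i, Continuous fun v : EllTwo => v i := fun i =>
    (lp.evalCLM ℝ (fun _ : ℕ => ℝ) 2 i).continuous
  have hfi : ∀ i, AEMeasurable (fun x => ‖f x i‖ₑ) μ := fun i =>
    ((hcoord i).comp_aestronglyMeasurable hf).enorm
  have hgi : ∀ i, Measurable fun x => ‖latticeMaximal μ 𝒟 f x i‖ₑ := fun i =>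
    ((hcoord i).comp_stronglyMeasurable (stronglyMeasurable_latticeMaximal
      (fun Q hQ => (h𝒟 Q hQ).measurableSet) f)).enorm
  simp_rw [enorm_sq_eq_tsum]
  rw [lintegral_tsum fun i => ((hgi i).pow_const 2).aemeasurable,
    lintegral_tsum fun i => (hfi i).pow_const 2, ← ENNReal.tsum_mul_left]
  refine ENNReal.tsum_le_tsum fun i => lintegral_sq_le_of_le_maximal μ h𝒟 (hfi i)
    (fun x => enorm_ne_top) fun x t ht => ?_
  have e : ‖latticeMaximal μ 𝒟 f x i‖ₑ =
      ((({Q ∈ 𝒟 | x ∈ Q} : Finset _).sup fun Q => ‖(⨍ y in Q, f y ∂μ) i‖₊ : ℝ≥0) : ℝ≥0∞) := by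
    rw [latticeMaximal, supAbs_apply, Real.enorm_of_nonneg (NNReal.coe_nonneg _),
      ENNReal.ofReal_coe_nnreal]
  rw [e] at ht
  lift t to ℝ≥0 using ht.ne_top
  obtain ⟨Q, hQ, htQ⟩ := (Finset.lt_sup_iff).1 (ENNReal.coe_lt_coe.1 ht)
  obtain ⟨hQ, hxQ⟩ := Finset.mem_filter.1 hQ
  refine ⟨Q, hQ, hxQ, le_trans ?_ (measure_mul_enorm_setAverage_apply_le
    ((h𝒟 Q hQ).measure_lt_top μ).ne (hfint Q hQ) i)⟩
  gcongr
  exact ENNReal.coe_le_coe.2 htQ.le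

/-! ### The testing condition on the levels of the maximal function -/

/-- The set where the lattice maximal function of `f` has norm greater than `2 ^ k`. -/
def superlevelSet (μ : Measure (Fin d → ℝ)) (𝒟 : Finset (Set (Fin d → ℝ)))
    (f : (Fin d → ℝ) → EllTwo) (k : ℤ) : Set (Fin d → ℝ) :=
  {x | (2 : ℝ≥0∞) ^ k < ‖latticeMaximal μ 𝒟 f x‖ₑ}

theorem measurableSet_superlevelSet (h𝒟 : ∀ Q ∈ 𝒟, MeasurableSet Q)
    (f : (Fin d → ℝ) → EllTwo) (k : ℤ) : MeasurableSet (superlevelSet μ 𝒟 f k) :=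
  measurableSet_lt measurable_const (stronglyMeasurable_latticeMaximal h𝒟 f).enorm

/-- Each cube with a non-zero average has a last level `k` for which the superlevel set fills more
than half of it. -/
theorem exists_level [IsLocallyFiniteMeasure μ] (h𝒟 : ∀ Q ∈ 𝒟, IsDyadicCube Q)
    (f : (Fin d → ℝ) → EllTwo) {Q : Set (Fin d → ℝ)} (hQ : Q ∈ 𝒟)
    (ha : ⨍ x in Q, f x ∂μ ≠ 0) :
    ∃ k : ℤ, μ Q < 2 * μ (Q ∩ superlevelSet μ 𝒟 f k) ∧
      2 * μ (Q ∩ superlevelSet μ 𝒟 f (k + 1)) ≤ μ Q := by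
  have h12 : (1 : ℝ≥0∞) < 2 := by norm_num
  have h2' : (2 : ℝ≥0∞) ≠ ⊤ := by norm_num
  have hQ0 : μ Q ≠ 0 := fun h => ha <| by
    rw [setAverage_eq, Measure.real, h]; simp
  have hlow : ∃ k : ℤ, μ Q < 2 * μ (Q ∩ superlevelSet μ 𝒟 f k) := by
    obtain ⟨n, hn, -⟩ := ENNReal.exists_mem_Ioc_zpow (enorm_ne_zero.2 ha) enorm_ne_top h12 h2'
    refine ⟨n, ?_⟩
    have hsub : Q ⊆ superlevelSet μ 𝒟 f n := fun x hx => hn.trans_le <|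
      enorm_le_iff_norm_le.2 <| norm_le_norm_of_abs_le fun i =>
        abs_setAverage_le_latticeMaximal f hQ hx i
    rw [Set.inter_eq_left.2 hsub, two_mul]
    exact ENNReal.lt_add_right ((h𝒟 Q hQ).measure_lt_top μ).ne hQ0
  have hup : ∃ b : ℤ, ∀ k : ℤ, μ Q < 2 * μ (Q ∩ superlevelSet μ 𝒟 f k) → k ≤ b := by
    obtain ⟨b, hb⟩ : ∃ b : ℤ, ‖supAbs 𝒟 fun Q => ⨍ y in Q, f y ∂μ‖ₑ ≤ (2 : ℝ≥0∞) ^ b := by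
      by_cases h0 : ‖supAbs 𝒟 fun Q => ⨍ y in Q, f y ∂μ‖ₑ = 0
      · exact ⟨0, by rw [h0]; exact zero_le⟩
      · obtain ⟨n, -, hn⟩ := ENNReal.exists_mem_Ioc_zpow h0 enorm_ne_top h12 h2'
        exact ⟨n + 1, hn⟩
    refine ⟨b, fun k hk => ?_⟩
    by_contra! hbk
    have hempty : superlevelSet μ 𝒟 f k = ∅ := by
      refine Set.eq_empty_of_forall_notMem fun x hx => ?_
      refine (not_lt.2 ?_ : ¬ (2 : ℝ≥0∞) ^ k < ‖latticeMaximal μ 𝒟 f x‖ₑ) hx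
      exact (enorm_le_iff_norm_le.2 (norm_latticeMaximal_le f x)).trans
        (hb.trans (ENNReal.zpow_le_of_le h12.le hbk.le))
    simp [hempty] at hk
  obtain ⟨k, hk, hmax⟩ := Int.exists_greatest_of_bdd hup hlow
  exact ⟨k, hk, not_lt.1 fun h => by have := hmax _ h; lia⟩

open scoped Classical in
/-- The testing condition bounds the contribution of the cubes of one level inside a cube `R`:
the bounded test function is the lattice maximal function of `f`, cut off at height
`2 ^ (k + 1)`. -/
theorem ofReal_carlesonSum_le_of_subset [IsLocallyFiniteMeasure μ]
    (h𝒟 : ∀ Q ∈ 𝒟, IsDyadicCube Q) (hlam : ∀ Q ∈ 𝒟, HasNonnegEntries (lam Q))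
    (f : (Fin d → ℝ) → EllTwo) (k : ℤ) {R : Set (Fin d → ℝ)} (hR : R ∈ 𝒟)
    {F : Finset (Set (Fin d → ℝ))} (hF : F ⊆ {Q ∈ 𝒟 | Q ⊆ R}) (hF0 : ∀ Q ∈ F, μ Q ≠ 0)
    (hFk : ∀ Q ∈ F, 2 * μ (Q ∩ superlevelSet μ 𝒟 f (k + 1)) ≤ μ Q) :
    ENNReal.ofReal (carlesonSum μ F lam f) ≤
      16 * testingConst μ 𝒟 lam * ((2 : ℝ≥0∞) ^ k) ^ 2 * μ R := by
  have h2 : (2 : ℝ≥0∞) ≠ 0 := by norm_num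
  have h2' : (2 : ℝ≥0∞) ≠ ⊤ := by norm_num
  have hmeas : ∀ Q ∈ 𝒟, MeasurableSet Q := fun Q hQ => (h𝒟 Q hQ).measurableSet
  have hΩ := measurableSet_superlevelSet (μ := μ) hmeas f (k + 1)
  set h : (Fin d → ℝ) → EllTwo :=
    (superlevelSet μ 𝒟 f (k + 1))ᶜ.indicator (latticeMaximal μ 𝒟 f) with hh
  have hsm : StronglyMeasurable h := (stronglyMeasurable_latticeMaximal hmeas f).indicator hΩ.compl
  have hbd : ∀ x, ‖(2 : ℝ) • h x‖ₑ ≤ 4 * 2 ^ k := fun x => by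
    have hle : ‖h x‖ₑ ≤ 2 ^ (k + 1) := by
      by_cases hx : x ∈ superlevelSet μ 𝒟 f (k + 1)
      · rw [hh, Set.indicator_of_notMem (by simpa using hx)]
        simp
      · rw [hh, Set.indicator_of_mem (by simpa using hx)]
        exact not_lt.1 hx
    rw [enorm_smul, Real.enorm_of_nonneg zero_le_two, ENNReal.ofReal_ofNat]
    calc 2 * ‖h x‖ₑ ≤ 2 * 2 ^ (k + 1) := by gcongr
      _ = 4 * 2 ^ k := by rw [ENNReal.zpow_add h2 h2', zpow_one]; ring
  have hnorm : ∀ S, eLpNorm (fun x => (2 : ℝ) • h x) ∞ (μ.restrict S) ≤ 4 * 2 ^ k := fun S => by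
    rw [eLpNorm_exponent_top]
    exact essSup_le_of_ae_le _ (Filter.Eventually.of_forall hbd)
  have hmem : ∀ S, MemLp (fun x => (2 : ℝ) • h x) ∞ (μ.restrict S) := fun S =>
    ⟨(hsm.const_smul (2 : ℝ)).aestronglyMeasurable, (hnorm S).trans_lt
      (ENNReal.mul_lt_top (by norm_num) (ENNReal.zpow_lt_top h2 h2' k))⟩
  have hint : ∀ Q ∈ 𝒟, IntegrableOn (fun x => (2 : ℝ) • h x) Q μ := fun Q hQ => by
    have : IsFiniteMeasure (μ.restrict Q) := ⟨by simpa using (h𝒟 Q hQ).measure_lt_top μ⟩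
    exact (hmem Q).integrable le_top
  have hnn : ∀ x i, 0 ≤ h x i := fun x i => by
    by_cases hx : x ∈ (superlevelSet μ 𝒟 f (k + 1))ᶜ
    · rw [hh, Set.indicator_of_mem hx]; exact latticeMaximal_nonneg f x i
    · rw [hh, Set.indicator_of_notMem hx]; exact le_rfl
  have hmono : carlesonSum μ F lam f ≤
      carlesonSum μ {Q ∈ 𝒟 | Q ⊆ R} lam fun x => (2 : ℝ) • h x := by
    refine carlesonSum_le_carlesonSum hF (fun Q hQ => hlam Q (Finset.mem_filter.1 hQ).1)
      (fun Q hQ => ?_) fun Q hQ => setAverage_apply_nonneg (hint Q (Finset.mem_filter.1 hQ).1)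
        fun x i => mul_nonneg zero_le_two (hnn x i)
    have hQ𝒟 : Q ∈ 𝒟 := (Finset.mem_filter.1 (hF hQ)).1
    have hQtop : μ Q ≠ ⊤ := ((h𝒟 Q hQ𝒟).measure_lt_top μ).ne
    refine abs_le_setAverage_two_smul (E := Q \ superlevelSet μ 𝒟 f (k + 1)) (hF0 Q hQ) hQtop
      Set.sdiff_subset ((hmeas Q hQ𝒟).diff hΩ) ?_ ?_ hnn fun x hx i => ?_
    · have hsplit := measure_inter_add_sdiff (μ := μ) Q hΩ
      have hItop : 2 * μ (Q ∩ superlevelSet μ 𝒟 f (k + 1)) ≠ ⊤ :=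
        ((hFk Q hQ).trans_lt hQtop.lt_top).ne
      refine (ENNReal.add_le_add_iff_left hItop).1 ?_
      calc 2 * μ (Q ∩ superlevelSet μ 𝒟 f (k + 1)) + μ Q ≤ μ Q + μ Q := by gcongr; exact hFk Q hQ
        _ = 2 * (μ (Q ∩ superlevelSet μ 𝒟 f (k + 1)) +
            μ (Q \ superlevelSet μ 𝒟 f (k + 1))) := by rw [hsplit, two_mul]
        _ = _ := mul_add _ _ _
    · have := (hint Q hQ𝒟).smul (2⁻¹ : ℝ)
      refine this.congr (Filter.Eventually.of_forall fun x => ?_)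
      simp [smul_smul]
    · rw [hh, Set.indicator_of_mem (by simpa using hx.2)]
      exact abs_setAverage_le_latticeMaximal f hQ𝒟 hx.1 i
  calc ENNReal.ofReal (carlesonSum μ F lam f)
      ≤ ENNReal.ofReal (carlesonSum μ {Q ∈ 𝒟 | Q ⊆ R} lam fun x => (2 : ℝ) • h x) :=
        ENNReal.ofReal_le_ofReal hmono
    _ ≤ testingConst μ 𝒟 lam *
          (eLpNorm (fun x => (2 : ℝ) • h x) ∞ (μ.restrict R) ^ 2 * μ R) :=
        ofReal_carlesonSum_le_testingConst_mul hR ((h𝒟 R hR).measure_lt_top μ).ne (hmem R)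
    _ ≤ testingConst μ 𝒟 lam * ((4 * 2 ^ k) ^ 2 * μ R) := by gcongr; exact hnorm R
    _ = _ := by ring

/-- Summing the bound inside `R` over the maximal cubes `R` of level `k`. -/
theorem ofReal_carlesonSum_level_le [IsLocallyFiniteMeasure μ]
    (h𝒟 : ∀ Q ∈ 𝒟, IsDyadicCube Q) (hlam : ∀ Q ∈ 𝒟, HasNonnegEntries (lam Q))
    (f : (Fin d → ℝ) → EllTwo) (k : ℤ) {F : Finset (Set (Fin d → ℝ))} (hF : F ⊆ 𝒟)
    (hFk : ∀ Q ∈ F, μ Q < 2 * μ (Q ∩ superlevelSet μ 𝒟 f k) ∧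
      2 * μ (Q ∩ superlevelSet μ 𝒟 f (k + 1)) ≤ μ Q) :
    ENNReal.ofReal (carlesonSum μ F lam f) ≤
      32 * testingConst μ 𝒟 lam * (((2 : ℝ≥0∞) ^ k) ^ 2 * μ (superlevelSet μ 𝒟 f k)) := by
  classical
  obtain ⟨S, hSF, hcov, hsum⟩ := exists_maximal_subfamily fun Q hQ => h𝒟 Q (hF hQ)
  choose! ρ hρS hρ using hcov
  have hF0 : ∀ Q ∈ F, μ Q ≠ 0 := fun Q hQ h0 => by
    have := (hFk Q hQ).1
    rw [measure_mono_null Set.inter_subset_left h0] at this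
    simp at this
  have hmass : ∑ R ∈ S, μ R ≤ 2 * μ (superlevelSet μ 𝒟 f k) := by
    simpa using hsum μ (μ.restrict (superlevelSet μ 𝒟 f k)) 2 fun Q hQ => by
      rw [Measure.restrict_apply (h𝒟 Q (hF hQ)).measurableSet]
      exact (hFk Q hQ).1.le
  calc ENNReal.ofReal (carlesonSum μ F lam f)
      = ENNReal.ofReal (∑ R ∈ S, carlesonSum μ {Q ∈ F | ρ Q = R} lam f) := by
        simp only [carlesonSum]
        rw [Finset.sum_fiberwise_of_maps_to hρS]
    _ ≤ ∑ R ∈ S, ENNReal.ofReal (carlesonSum μ {Q ∈ F | ρ Q = R} lam f) :=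
        Finset.le_sum_of_subadditive _ ENNReal.ofReal_zero.le (fun _ _ => ENNReal.ofReal_add_le) _ _
    _ ≤ ∑ R ∈ S, 16 * testingConst μ 𝒟 lam * ((2 : ℝ≥0∞) ^ k) ^ 2 * μ R := by
        refine Finset.sum_le_sum fun R hR => ofReal_carlesonSum_le_of_subset h𝒟 hlam f k
          (hF (hSF hR)) (fun Q hQ => ?_) (fun Q hQ => hF0 Q (Finset.mem_filter.1 hQ).1)
          fun Q hQ => (hFk Q (Finset.mem_filter.1 hQ).1).2
        obtain ⟨hQF, rfl⟩ := Finset.mem_filter.1 hQ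
        exact Finset.mem_filter.2 ⟨hF hQF, hρ Q hQF⟩
    _ ≤ 16 * testingConst μ 𝒟 lam * ((2 : ℝ≥0∞) ^ k) ^ 2 *
          (2 * μ (superlevelSet μ 𝒟 f k)) := by rw [← Finset.mul_sum]; gcongr
    _ = _ := by ring

theorem sum_measure_superlevelSet_le (h𝒟 : ∀ Q ∈ 𝒟, MeasurableSet Q)
    (f : (Fin d → ℝ) → EllTwo) (K : Finset ℤ) :
    ∑ k ∈ K, ((2 : ℝ≥0∞) ^ k) ^ 2 * μ (superlevelSet μ 𝒟 f k) ≤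
      2 * ∫⁻ x, ‖latticeMaximal μ 𝒟 f x‖ₑ ^ 2 ∂μ := by
  have hΩ := measurableSet_superlevelSet (μ := μ) h𝒟 f
  calc ∑ k ∈ K, ((2 : ℝ≥0∞) ^ k) ^ 2 * μ (superlevelSet μ 𝒟 f k)
      = ∫⁻ x, ∑ k ∈ K, (superlevelSet μ 𝒟 f k).indicator
          (fun _ => ((2 : ℝ≥0∞) ^ k) ^ 2) x ∂μ := by
        rw [lintegral_finsetSum _ fun k _ => measurable_const.indicator (hΩ k)]
        simp_rw [lintegral_indicator_const (hΩ _)]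
    _ ≤ ∫⁻ x, 2 * ‖latticeMaximal μ 𝒟 f x‖ₑ ^ 2 ∂μ := by
        refine lintegral_mono fun x => (ENNReal.sum_le_tsum K).trans ?_
        refine le_of_eq_of_le (tsum_congr fun k => ?_)
          (tsum_four_zpow_lt_le ‖latticeMaximal μ 𝒟 f x‖ₑ)
        simp only [Set.indicator, superlevelSet, Set.mem_ofPred_eq]
        congr
    _ = _ := lintegral_const_mul _ ((stronglyMeasurable_latticeMaximal h𝒟 f).enorm.pow_const 2)

theorem embeddingConst_le_testingConst [IsLocallyFiniteMeasure μ]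
    (h𝒟 : ∀ Q ∈ 𝒟, IsDyadicCube Q) (hlam : ∀ Q ∈ 𝒟, HasNonnegEntries (lam Q)) :
    embeddingConst μ 𝒟 lam ≤ 2048 * testingConst μ 𝒟 lam := by
  classical
  refine iSup₂_le fun f hf => ENNReal.div_le_of_le_mul ?_
  have hint : ∀ Q ∈ 𝒟, IntegrableOn f Q μ := fun Q hQ => by
    have : IsFiniteMeasure (μ.restrict Q) := ⟨by simpa using (h𝒟 Q hQ).measure_lt_top μ⟩
    exact (hf.restrict Q).integrable (by norm_num)
  have hlevel : ∀ Q ∈ ({Q ∈ 𝒟 | ⨍ x in Q, f x ∂μ ≠ 0} : Finset _), ∃ k : ℤ,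
      μ Q < 2 * μ (Q ∩ superlevelSet μ 𝒟 f k) ∧
        2 * μ (Q ∩ superlevelSet μ 𝒟 f (k + 1)) ≤ μ Q := fun Q hQ =>
    exists_level h𝒟 f (Finset.mem_filter.1 hQ).1 (Finset.mem_filter.1 hQ).2
  choose! κ hκ using hlevel
  set F : Finset (Set (Fin d → ℝ)) := {Q ∈ 𝒟 | ⨍ x in Q, f x ∂μ ≠ 0} with hFdef
  -- A cube on which `f` has average zero may have no level, but it contributes nothing.
  have hsplit : carlesonSum μ 𝒟 lam f =
      ∑ k ∈ F.image κ, carlesonSum μ {Q ∈ F | κ Q = k} lam f := by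
    simp only [carlesonSum]
    rw [Finset.sum_fiberwise_of_maps_to fun Q hQ => Finset.mem_image_of_mem κ hQ]
    refine (Finset.sum_subset (Finset.filter_subset _ _) fun Q hQ hQF => ?_).symm
    have h0 : ⨍ x in Q, f x ∂μ = 0 := by
      by_contra h
      exact hQF (Finset.mem_filter.2 ⟨hQ, h⟩)
    rw [h0, inner_zero_left]
  calc ENNReal.ofReal (carlesonSum μ 𝒟 lam f)
      ≤ ∑ k ∈ F.image κ, ENNReal.ofReal (carlesonSum μ {Q ∈ F | κ Q = k} lam f) := by
        rw [hsplit]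
        exact Finset.le_sum_of_subadditive _ ENNReal.ofReal_zero.le
          (fun _ _ => ENNReal.ofReal_add_le) _ _
    _ ≤ ∑ k ∈ F.image κ, 32 * testingConst μ 𝒟 lam *
          (((2 : ℝ≥0∞) ^ k) ^ 2 * μ (superlevelSet μ 𝒟 f k)) := by
        refine Finset.sum_le_sum fun k _ => ofReal_carlesonSum_level_le h𝒟 hlam f k
          ((Finset.filter_subset _ _).trans (Finset.filter_subset _ _)) fun Q hQ => ?_
        obtain ⟨hQF, rfl⟩ := Finset.mem_filter.1 hQ
        exact hκ Q hQF
    _ ≤ 32 * testingConst μ 𝒟 lam * (2 * (32 * ∫⁻ x, ‖f x‖ₑ ^ 2 ∂μ)) := by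
        rw [← Finset.mul_sum]
        gcongr
        refine (sum_measure_superlevelSet_le (fun Q hQ => (h𝒟 Q hQ).measurableSet) f _).trans ?_
        gcongr
        exact lintegral_latticeMaximal_sq_le h𝒟 hf.1 hint
    _ = 2048 * testingConst μ 𝒟 lam * eLpNorm f 2 μ ^ 2 := by rw [eLpNorm_two_sq]; ring

end CarlesonEmbedding

theorem mainTheorem8 :
    ∃ C : ℝ≥0, ∀ (d : ℕ) (μ : Measure (Fin d → ℝ)) [IsLocallyFiniteMeasure μ]
      (𝒟 : Finset (Set (Fin d → ℝ))) (_ : ∀ Q ∈ 𝒟, CarlesonEmbedding.IsDyadicCube Q)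
      (lam : Set (Fin d → ℝ) → CarlesonEmbedding.EllTwo →L[ℝ] CarlesonEmbedding.EllTwo)
      (_ : ∀ Q ∈ 𝒟, CarlesonEmbedding.IsSymmMatrix (lam Q))
      (_ : ∀ Q ∈ 𝒟, CarlesonEmbedding.HasNonnegEntries (lam Q)),
      CarlesonEmbedding.embeddingConst μ 𝒟 lam ≤ C * CarlesonEmbedding.testingConst μ 𝒟 lam ∧
      CarlesonEmbedding.testingConst μ 𝒟 lam ≤ C * CarlesonEmbedding.embeddingConst μ 𝒟 lam := by
  refine ⟨2048, fun d μ _ 𝒟 h𝒟 lam _ hlam => ⟨?_, ?_⟩⟩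
  · exact CarlesonEmbedding.embeddingConst_le_testingConst h𝒟 hlam
  · refine (CarlesonEmbedding.testingConst_le_embeddingConst h𝒟 hlam).trans
      (le_mul_of_one_le_left zero_le ?_)
    norm_num
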